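/- Let $R$ be a commutative noetherian ring and let $R\text{-Mod}$ be the category of finitely generated $R$-modules. Let $T\colon D\to R\text{-Mod}$ be a representation of a diagram (directed graph) $D$, i.e. a choice of a finitely generated $R$-module $Tp$ for every object $p$ and of an $R$-linear map $Tm\colon Tp\to Tq$ for every $m\in M(p,q)$. For a finite set $F$ of objects of $D$, regarded as a full subdiagram, put $$\mathrm{End}(T_{|F})=\Bigl\{(e_p)_{p\in F}\in\prod_{p\in F}\mathrm{End}_R(Tp)\ :\ Tm\circ e_p=e_q\circ Tm\ \text{ for all } p,q\in F,\ m\in M(p,q)\Bigr\},$$ an $R$-algebra, and let $\mathrm{End}(T_{|F})\text{-Mod}$ be the category of finitely generated left $\mathrm{End}(T_{|F})$-modules. For $F\subseteq F'$ the projection $\mathrm{End}(T_{|F'})\to\mathrm{End}(T_{|F})$ gives a restriction of scalars functor $\mathrm{End}(T_{|F})\text{-Mod}\to\mathrm{End}(T_{|F'})\text{-Mod}$. The diagram category of $T$ is the direct limit of categories $$\mathcal C(T)=\varinjlim_{F\subseteq D\ \text{finite}}\mathrm{End}(T_{|F})\text{-Mod},$$ whose objects and morphisms are the direct limits of the sets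 of objects and of morphisms. Let $\tilde T\colon D\to\mathcal C(T)$ be the representation sending $p$ to the class of $Tp$ (with its natural action of $\mathrm{End}(T_{|F})$, for any finite $F\ni p$) and $m$ to the class of $Tm$, and let $ff_T\colon\mathcal C(T)\to R\text{-Mod}$ be the forgetful functor. Let $\mathcal A$ be an $R$-linear abelian category and $T\colon\mathcal A\to R\text{-Mod}$ a faithful, exact, $R$-linear functor, regarded as a representation of the underlying diagram of $\mathcal A$. Then $\tilde T$ is a functor, $T$ factors as $T=ff_T\circ\tilde T\colon\mathcal A\to\mathcal C(T)\to R\text{-Mod}$, and $\tilde T\colon\mathcal A\to\mathcal C(T)$ is an equivalence of categories, i.e. it is faithful, full and essentially surjective. -/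

import Mathlib

open CategoryTheory

universe v u w t s

/-! ### The direct limit of a directed system of categories -/

namespace DirectedColimit

variable {I : Type w} [Preorder I] (C : I ⥤ Cat.{v, u})

/-- The transition functor `C i ⥤ C j` of the system, for `i ≤ j`. -/
abbrev tr {i j : I} (h : i ≤ j) : C.obj i ⥤ C.obj j := (C.map (homOfLE h)).toFunctor

theorem tr_comp {i j k : I} (h : i ≤ j) (h' : j ≤ k) :
    tr C h ⋙ tr C h' = tr C (h.trans h') := by
  have := C.map_comp (homOfLE h) (homOfLE h')
  exact (congrArg Cat.Hom.toFunctor this).symm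

theorem tr_refl (i : I) : tr C (le_refl i) = 𝟭 _ := by
  have := C.map_id i
  exact congrArg Cat.Hom.toFunctor this

theorem tr_obj {i j k : I} (h : i ≤ j) (h' : j ≤ k) (A : C.obj i) :
    (tr C h').obj ((tr C h).obj A) = (tr C (h.trans h')).obj A :=
  Functor.congr_obj (tr_comp C h h') A

/-- The image of a morphism `f` of `C i` in `C j`, as an element of the set of all morphisms
of `C j`. -/
def push {i j : I} (h : i ≤ j) (f : Arrow (C.obj i)) : Arrow (C.obj j) :=
  Arrow.mk ((tr C h).map f.hom)

theorem push_push {i j k : I} (h : i ≤ j) (h' : j ≤ k) (f : Arrow (C.obj i)) :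
    push C h' (push C h f) = push C (h.trans h') f :=
  congrArg (fun F : C.obj i ⥤ C.obj k => Arrow.mk (F.map f.hom)) (tr_comp C h h')

theorem push_refl {i : I} (f : Arrow (C.obj i)) : push C (le_refl i) f = f :=
  congrArg (fun F : C.obj i ⥤ C.obj i => Arrow.mk (F.map f.hom)) (tr_refl C i)

/-- Two morphisms `f` of `C i` and `g` of `C j` are identified if they have the same image in some
`C k` (in particular the images have the same source and the same target). -/
def Agree {i j : I} (f : Arrow (C.obj i)) (g : Arrow (C.obj j)) : Prop :=
  ∃ (k : I) (hi : i ≤ k) (hj : j ≤ k), push C hi f = push C hj g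

variable {C} in
theorem Agree.symm {i j : I} {f : Arrow (C.obj i)} {g : Arrow (C.obj j)} (h : Agree C f g) :
    Agree C g f := by
  obtain ⟨k, hi, hj, h⟩ := h
  exact ⟨k, hj, hi, h.symm⟩

variable {C} in
theorem agree_refl {i : I} (f : Arrow (C.obj i)) : Agree C f f := ⟨i, le_rfl, le_rfl, rfl⟩

variable {C} in
theorem agree_push {i j : I} (h : i ≤ j) (f : Arrow (C.obj i)) : Agree C (push C h f) f :=
  ⟨j, le_rfl, h, by rw [push_push]⟩

/-- `g ∘ f` for two morphisms that are composable up to an equality of objects. -/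
def compEq {B : Type u} [Category.{v} B] {a b c d : B} (f : a ⟶ b) (h : b = c) (g : c ⟶ d) :
    Arrow B :=
  Arrow.mk (f ≫ eqToHom h ≫ g)

theorem compEq_congr {B : Type u} [Category.{v} B] {a b c d a' b' c' d' : B}
    {f : a ⟶ b} {h : b = c} {g : c ⟶ d} {f' : a' ⟶ b'} {h' : b' = c'} {g' : c' ⟶ d'}
    (hf : Arrow.mk f = Arrow.mk f') (hg : Arrow.mk g = Arrow.mk g') :
    compEq f h g = compEq f' h' g' := by
  cases hf
  cases hg
  rfl

variable {C} in
theorem push_compEq {i j : I} (hij : i ≤ j) {a b c d : C.obj i} (f : a ⟶ b) (h : b = c)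
    (g : c ⟶ d) :
    push C hij (compEq f h g) =
      compEq ((tr C hij).map f) (congrArg (tr C hij).obj h) ((tr C hij).map g) := by
  cases h
  simp [push, compEq]

variable {C} in
theorem desc_agree {E : Type*} [Category E] (χ : ∀ i, C.obj i ⥤ E)
    (hχ : ∀ (i j : I) (h : i ≤ j), tr C h ⋙ χ j = χ i)
    {i j : I} {f : Arrow (C.obj i)} {g : Arrow (C.obj j)} (h : Agree C f g) :
    Arrow.mk ((χ i).map f.hom) = Arrow.mk ((χ j).map g.hom) := by
  have key : ∀ {i j : I} (h : i ≤ j) (f : Arrow (C.obj i)),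
      Arrow.mk ((χ j).map (push C h f).hom) = Arrow.mk ((χ i).map f.hom) := fun h f =>
    congrArg (fun F : C.obj _ ⥤ E => Arrow.mk (F.map f.hom)) (hχ _ _ h)
  obtain ⟨k, hi, hj, h⟩ := h
  rw [← key hi, h, key hj]

variable [IsDirectedOrder I]

/-- Two objects `A` of `C i` and `B` of `C j` are identified if they have the same image in some
`C k`. -/
def objSetoid : Setoid (Σ i, C.obj i) where
  r A B := ∃ (k : I) (hi : A.1 ≤ k) (hj : B.1 ≤ k), (tr C hi).obj A.2 = (tr C hj).obj B.2
  iseqv :=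
    { refl := fun A => ⟨A.1, le_rfl, le_rfl, rfl⟩
      symm := fun ⟨k, hi, hj, h⟩ => ⟨k, hj, hi, h.symm⟩
      trans := by
        rintro _ _ _ ⟨k, hi, hj, h⟩ ⟨l, hi', hj', h'⟩
        obtain ⟨m, hk, hl⟩ := exists_ge_ge k l
        refine ⟨m, hi.trans hk, hj'.trans hl, ?_⟩
        rw [← tr_obj C hi hk, h, tr_obj, ← tr_obj C hj' hl, ← h', tr_obj] }

/-- The objects of the direct limit: the direct limit of the sets of objects. -/
def Colim : Type (max w u) := Quotient (objSetoid C)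

variable {C}

/-- The class of an object of `C i` in the direct limit. -/
def cls {i : I} (A : C.obj i) : Colim C := Quotient.mk (objSetoid C) ⟨i, A⟩

theorem cls_eq_iff {i j : I} {A : C.obj i} {B : C.obj j} :
    cls A = cls B ↔
      ∃ (k : I) (hi : i ≤ k) (hj : j ≤ k), (tr C hi).obj A = (tr C hj).obj B :=
  Quotient.eq (r := objSetoid C)

theorem cls_tr {i j : I} (h : i ≤ j) (A : C.obj i) : cls ((tr C h).obj A) = cls A :=
  cls_eq_iff.2 ⟨j, le_rfl, h, by rw [tr_obj]⟩

/-- A morphism of some `C i` whose source and target represent the classes `x` and `y`. -/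
structure PreHom (x y : Colim C) where
  idx : I
  src : C.obj idx
  tgt : C.obj idx
  hom : src ⟶ tgt
  src_eq : cls src = x
  tgt_eq : cls tgt = y

theorem Agree.trans {i j k : I} {f : Arrow (C.obj i)} {g : Arrow (C.obj j)} {e : Arrow (C.obj k)}
    (h : Agree C f g) (h' : Agree C g e) : Agree C f e := by
  obtain ⟨l, hi, hj, h⟩ := h
  obtain ⟨l', hi', hj', h'⟩ := h'
  obtain ⟨m, hk, hl⟩ := exists_ge_ge l l'
  refine ⟨m, hi.trans hk, hj'.trans hl, ?_⟩
  rw [← push_push C hi hk, h, push_push, ← push_push C hj' hl, ← h', push_push]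

instance homSetoid (x y : Colim C) : Setoid (PreHom x y) where
  r f g := Agree C (Arrow.mk f.hom) (Arrow.mk g.hom)
  iseqv := ⟨fun _ => agree_refl _, Agree.symm, Agree.trans⟩

/-- The morphisms from `x` to `y` in the direct limit. -/
def Hom (x y : Colim C) : Type (max u v w) := Quotient (homSetoid x y)

/-- Composition is compatible with passing to a larger index and with the identifications. -/
theorem agree_compEq {i j : I} {a b c d : C.obj i} {f : a ⟶ b} {h : b = c} {g : c ⟶ d}
    {a' b' c' d' : C.obj j} {f' : a' ⟶ b'} {h' : b' = c'} {g' : c' ⟶ d'}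
    (hf : Agree C (Arrow.mk f) (Arrow.mk f')) (hg : Agree C (Arrow.mk g) (Arrow.mk g')) :
    Agree C (compEq f h g) (compEq f' h' g') := by
  obtain ⟨k, hi, hj, hf⟩ := hf
  obtain ⟨k', hi', hj', hg⟩ := hg
  obtain ⟨l, hk, hk'⟩ := exists_ge_ge k k'
  refine ⟨l, hi.trans hk, hj.trans hk, ?_⟩
  rw [push_compEq, push_compEq]
  apply compEq_congr
  · change push C _ (Arrow.mk f) = push C _ (Arrow.mk f')
    rw [← push_push C hi hk, hf, push_push]
  · change push C _ (Arrow.mk g) = push C _ (Arrow.mk g')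
    rw [← push_push C hi' hk', hg, push_push]

theorem PreHom.exists_comp {x y z : Colim C} (f : PreHom x y) (g : PreHom y z) :
    ∃ (k : I) (hi : f.idx ≤ k) (hj : g.idx ≤ k), (tr C hi).obj f.tgt = (tr C hj).obj g.src :=
  cls_eq_iff.1 (f.tgt_eq.trans g.src_eq.symm)

/-- The composite of two representatives, formed at an index where they become composable. -/
noncomputable def PreHom.comp {x y z : Colim C} (f : PreHom x y) (g : PreHom y z) :
    PreHom x z where
  idx := (f.exists_comp g).choose
  src := (tr C (f.exists_comp g).choose_spec.choose).obj f.src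
  tgt := (tr C (f.exists_comp g).choose_spec.choose_spec.choose).obj g.tgt
  hom := (tr C (f.exists_comp g).choose_spec.choose).map f.hom ≫
    eqToHom (f.exists_comp g).choose_spec.choose_spec.choose_spec ≫
      (tr C (f.exists_comp g).choose_spec.choose_spec.choose).map g.hom
  src_eq := (cls_tr _ _).trans f.src_eq
  tgt_eq := (cls_tr _ _).trans g.tgt_eq

/-- The composite may be computed with any composable representatives. -/
theorem PreHom.comp_agree {x y z : Colim C} (f : PreHom x y) (g : PreHom y z)
    {i : I} {a b c d : C.obj i} {f' : a ⟶ b} {h : b = c} {g' : c ⟶ d}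
    (hf : Agree C (Arrow.mk f.hom) (Arrow.mk f')) (hg : Agree C (Arrow.mk g.hom) (Arrow.mk g')) :
    Agree C (Arrow.mk (f.comp g).hom) (compEq f' h g') :=
  agree_compEq ((agree_push _ (Arrow.mk f.hom)).trans hf) ((agree_push _ (Arrow.mk g.hom)).trans hg)

theorem PreHom.comp_agree_comp {x y z x' y' z' : Colim C} {f : PreHom x y} {g : PreHom y z}
    {f' : PreHom x' y'} {g' : PreHom y' z'}
    (hf : Agree C (Arrow.mk f.hom) (Arrow.mk f'.hom))
    (hg : Agree C (Arrow.mk g.hom) (Arrow.mk g'.hom)) :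
    Agree C (Arrow.mk (f.comp g).hom) (Arrow.mk (f'.comp g').hom) :=
  PreHom.comp_agree f g (hf.trans (agree_push _ (Arrow.mk f'.hom)).symm)
    (hg.trans (agree_push _ (Arrow.mk g'.hom)).symm)

/-- The morphism of the direct limit represented by a morphism of `C i`. -/
def homMk {x y : Colim C} {i : I} {A B : C.obj i} (f : A ⟶ B) (hA : cls A = x) (hB : cls B = y) :
    Hom x y :=
  Quotient.mk _ ⟨i, A, B, f, hA, hB⟩

theorem homMk_eq_iff {x y : Colim C} {i j : I} {A B : C.obj i} {f : A ⟶ B} {hA : cls A = x}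
    {hB : cls B = y} {A' B' : C.obj j} {f' : A' ⟶ B'} {hA' : cls A' = x} {hB' : cls B' = y} :
    homMk f hA hB = homMk f' hA' hB' ↔ Agree C (Arrow.mk f) (Arrow.mk f') :=
  Quotient.eq

noncomputable instance : CategoryStruct (Colim C) where
  Hom := Hom
  id x := Quotient.mk _ ⟨x.out.1, x.out.2, x.out.2, 𝟙 _, x.out_eq, x.out_eq⟩
  comp {_ _ _} f g := Quotient.map₂ PreHom.comp
    (fun _ _ hf _ _ hg => PreHom.comp_agree_comp hf hg) f g

theorem agree_id {i j : I} {A : C.obj i} {B : C.obj j} (h : cls A = cls B) :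
    Agree C (Arrow.mk (𝟙 A)) (Arrow.mk (𝟙 B)) := by
  obtain ⟨k, hi, hj, h⟩ := cls_eq_iff.1 h
  refine ⟨k, hi, hj, ?_⟩
  change Arrow.mk ((tr C hi).map (𝟙 A)) = Arrow.mk ((tr C hj).map (𝟙 B))
  rw [CategoryTheory.Functor.map_id, CategoryTheory.Functor.map_id, h]

theorem id_eq_homMk {x : Colim C} {i : I} {A : C.obj i} (hA : cls A = x) :
    𝟙 x = homMk (𝟙 A) hA hA :=
  Quotient.sound (agree_id (x.out_eq.trans hA.symm))

theorem homMk_comp {x y z : Colim C} {i : I} {A B D : C.obj i} (f : A ⟶ B) (g : B ⟶ D)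
    (hA : cls A = x) (hB : cls B = y) (hD : cls D = z) :
    CategoryStruct.comp (X := x) (Y := y) (Z := z) (homMk f hA hB) (homMk g hB hD) =
      homMk (f ≫ g) hA hD := by
  refine Quotient.sound ?_
  have := PreHom.comp_agree ⟨i, A, B, f, hA, hB⟩ ⟨i, B, D, g, hB, hD⟩
    (h := rfl) (agree_refl _) (agree_refl _)
  simp only [compEq, eqToHom_refl, Category.id_comp] at this
  exact this

noncomputable instance : Category (Colim C) where
  id_comp {x y} f := by
    induction f using Quotient.ind with | _ f => ?_
    obtain ⟨i, A, B, f, hA, hB⟩ := f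
    rw [id_eq_homMk hA]
    exact (homMk_comp (𝟙 A) f hA hA hB).trans (by rw [Category.id_comp]; rfl)
  comp_id {x y} f := by
    induction f using Quotient.ind with | _ f => ?_
    obtain ⟨i, _, B, f, hA, hB⟩ := f
    rw [id_eq_homMk hB]
    exact (homMk_comp f (𝟙 B) hA hB hB).trans (by rw [Category.comp_id]; rfl)
  assoc {x y z t} f g h := by
    induction f using Quotient.ind with | _ f => ?_
    induction g using Quotient.ind with | _ g => ?_
    induction h using Quotient.ind with | _ h => ?_
    refine Quotient.sound ?_
    obtain ⟨k, h₁, h₂, e⟩ := f.exists_comp g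
    obtain ⟨k', h₂', h₃, e'⟩ := g.exists_comp h
    obtain ⟨l, hk, hk'⟩ := exists_ge_ge k k'
    have e₁ : (tr C (h₁.trans hk)).obj f.tgt = (tr C (h₂.trans hk)).obj g.src := by
      rw [← tr_obj C h₁ hk, e, tr_obj]
    have e₂ : (tr C (h₂.trans hk)).obj g.tgt = (tr C (h₃.trans hk')).obj h.src := by
      rw [← tr_obj C h₃ hk', ← e', tr_obj]
    have hf := (agree_push (h₁.trans hk) (Arrow.mk f.hom)).symm
    have hg := (agree_push (h₂.trans hk) (Arrow.mk g.hom)).symm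
    have hh := (agree_push (h₃.trans hk') (Arrow.mk h.hom)).symm
    have A₁ := PreHom.comp_agree (f.comp g) h (h := e₂) (PreHom.comp_agree f g (h := e₁) hf hg) hh
    have A₂ := PreHom.comp_agree f (g.comp h) (h := e₁) hf (PreHom.comp_agree g h (h := e₂) hg hh)
    refine A₁.trans (Agree.trans ?_ A₂.symm)
    simp only [compEq, Category.assoc]
    exact agree_refl _

/-- The canonical functor from `C i` to the direct limit. -/
noncomputable def ι (i : I) : C.obj i ⥤ Colim C where
  obj A := cls A
  map f := homMk f rfl rfl
  map_id _ := (id_eq_homMk rfl).symm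
  map_comp f g := (homMk_comp f g rfl rfl rfl).symm

section Desc

variable {E : Type*} [Category E]

theorem conj_congr {x y a b a' b' : E} {f : a ⟶ b} {f' : a' ⟶ b'}
    (h : Arrow.mk f = Arrow.mk f') (hx : x = a) (hy : b = y) (hx' : x = a') (hy' : b' = y) :
    eqToHom hx ≫ f ≫ eqToHom hy = eqToHom hx' ≫ f' ≫ eqToHom hy' := by
  cases h
  rfl

theorem conj_comp {x y z a b c d a' b' c' d' : E} {f : a ⟶ b} {g : c ⟶ d} {f' : a' ⟶ b'}
    {g' : c' ⟶ d'} (hf : Arrow.mk f = Arrow.mk f') (hg : Arrow.mk g = Arrow.mk g')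
    (hx : x = a) (hbc : b = c) (hz : d = z) (hx' : x = a') (hy : b' = y) (hy' : y = c')
    (hz' : d' = z) :
    eqToHom hx ≫ (f ≫ eqToHom hbc ≫ g) ≫ eqToHom hz =
      (eqToHom hx' ≫ f' ≫ eqToHom hy) ≫ (eqToHom hy' ≫ g' ≫ eqToHom hz') := by
  cases hf
  cases hg
  subst hx hy hz
  simp

theorem conj_map_comp {B : Type*} [Category B] (G : B ⥤ E) {a b c d : B} {x y z a' b' c' d' : E}
    {f : a ⟶ b} {g : c ⟶ d} {f' : a' ⟶ b'} {g' : c' ⟶ d'} (hf : Arrow.mk (G.map f) = Arrow.mk f')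
    (hg : Arrow.mk (G.map g) = Arrow.mk g') (hx : x = G.obj a) (hbc : b = c) (hz : G.obj d = z)
    (hx' : x = a') (hy : b' = y) (hy' : y = c') (hz' : d' = z) :
    eqToHom hx ≫ G.map (f ≫ eqToHom hbc ≫ g) ≫ eqToHom hz =
      (eqToHom hx' ≫ f' ≫ eqToHom hy) ≫ (eqToHom hy' ≫ g' ≫ eqToHom hz') := by
  rw [G.map_comp, G.map_comp, eqToHom_map]
  exact conj_comp hf hg _ _ _ _ _ _ _

variable (χ : ∀ i, C.obj i ⥤ E) (hχ : ∀ (i j : I) (h : i ≤ j), tr C h ⋙ χ j = χ i)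

/-- The map on objects induced by a compatible family of functors `χ i : C i ⥤ E`. -/
def descObj : Colim C → E :=
  Quotient.lift (fun A => (χ A.1).obj A.2) (by
    rintro ⟨i, A⟩ ⟨j, B⟩ ⟨k, hi, hj, h⟩
    rw [← hχ _ _ hi, ← hχ _ _ hj]
    exact congrArg (χ k).obj h)

theorem descObj_eq {x : Colim C} {i : I} {A : C.obj i} (h : cls A = x) :
    descObj χ hχ x = (χ i).obj A := by
  subst h
  rfl

/-- The map on morphisms induced by a compatible family of functors `χ i : C i ⥤ E`. -/
def descHom {x y : Colim C} (f : Hom x y) : descObj χ hχ x ⟶ descObj χ hχ y :=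
  Quotient.lift (fun f : PreHom x y =>
    eqToHom (descObj_eq χ hχ f.src_eq) ≫ (χ f.idx).map f.hom ≫
      eqToHom (descObj_eq χ hχ f.tgt_eq).symm)
    (fun _ _ hfg => conj_congr (desc_agree χ hχ hfg) _ _ _ _) f

/-- The functor on the direct limit induced by a compatible family of functors `χ i : C i ⥤ E`. -/
def desc : Colim C ⥤ E where
  obj := descObj χ hχ
  map f := descHom χ hχ f
  map_id x := by
    obtain ⟨⟨i, A⟩, hx⟩ := Quotient.exists_rep x
    refine (congrArg (descHom χ hχ) (id_eq_homMk (A := A) hx)).trans ?_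
    change eqToHom _ ≫ (χ i).map (𝟙 A) ≫ eqToHom _ = _
    simp
  map_comp {x y z} f g := by
    induction f using Quotient.ind with | _ f => ?_
    induction g using Quotient.ind with | _ g => ?_
    exact conj_map_comp (χ _) (desc_agree χ hχ (agree_push _ (Arrow.mk f.hom)))
      (desc_agree χ hχ (agree_push _ (Arrow.mk g.hom))) _ _ _ _ _ _ _

end Desc

end DirectedColimit

/-! ### The diagram category of a representation -/

namespace Nori

open DirectedColimit

variable {R : Type u} [CommRing R] {D : Type t} [Quiver.{s} D]

/-- For a representation `T` of a diagram `D` (a quiver) in the category of finitely generated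
`R`-modules and a finite full subdiagram `F` of `D`, the `R`-algebra `End(T|F)` of families
`(e_p)` in `∏_{p ∈ F} End_R(Tp)` with `Tm ∘ e_p = e_q ∘ Tm` for all `m : p ⟶ q` in `F`. -/
def EndAlg (T : D ⥤q FGModuleCat.{u} R) (F : Finset D) :
    Subalgebra R (∀ p : F, Module.End R (T.obj p)) where
  carrier := {e | ∀ (p q : F) (m : (p : D) ⟶ q), (T.map m).hom.hom ∘ₗ e p = e q ∘ₗ (T.map m).hom.hom}
  mul_mem' := by
    intro a b ha hb p q m
    have h₁ := ha p q m
    have h₂ := hb p q m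
    ext x
    have e₁ := fun y => LinearMap.congr_fun h₁ y
    have e₂ := LinearMap.congr_fun h₂ x
    simp only [LinearMap.comp_apply] at e₁ e₂
    simp only [Pi.mul_apply, LinearMap.comp_apply, Module.End.mul_apply, e₁, e₂]
  add_mem' := by
    intro a b ha hb p q m
    rw [Pi.add_apply, Pi.add_apply, LinearMap.comp_add, LinearMap.add_comp, ha p q m, hb p q m]
  algebraMap_mem' := by
    intro r p q m
    ext x
    simp [Pi.algebraMap_apply, Module.algebraMap_end_apply]

variable (T : D ⥤q FGModuleCat.{u} R)

/-- For `F ⊆ G`, the projection `End(T|G) → End(T|F)`. -/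
def proj {F G : Finset D} (h : F ≤ G) : EndAlg T G →ₐ[R] EndAlg T F where
  toFun e := ⟨fun p => e.1 ⟨p, h p.2⟩, fun p q m => e.2 ⟨p, h p.2⟩ ⟨q, h q.2⟩ m⟩
  map_one' := rfl
  map_mul' _ _ := rfl
  map_zero' := rfl
  map_add' _ _ := rfl
  commutes' _ := rfl

/-- For `p ∈ F`, the action of `End(T|F)` on `Tp`. -/
def actionHom {F : Finset D} {p : D} (hp : p ∈ F) : EndAlg T F →ₐ[R] Module.End R (T.obj p) where
  toFun e := e.1 ⟨p, hp⟩
  map_one' := rfl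
  map_mul' _ _ := rfl
  map_zero' := rfl
  map_add' _ _ := rfl
  commutes' _ := rfl

instance [IsNoetherianRing R] (F : Finset D) : Module.Finite R (EndAlg T F) := by
  have h : ∀ p : F, Module.Finite R (Module.End R (T.obj p)) := fun p => inferInstance
  have : IsNoetherian R (∀ p : F, Module.End R (T.obj p)) := isNoetherian_of_isNoetherianRing_of_finite R _
  exact Module.Finite.of_fg (IsNoetherian.noetherian (Subalgebra.toSubmodule (EndAlg T F)))

/-- A finitely generated `B`-module is finitely generated over `A`, for a homomorphism `A → B`
of `R`-algebras with `B` finite over `R`. -/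
theorem finite_restrict {R : Type*} [CommRing R] {A B : Type*} [Ring A] [Ring B] [Algebra R A] [Algebra R B]
    [Module.Finite R B] (f : A →ₐ[R] B) (M : ModuleCat.{u} B) (hM : ModuleCat.isFG B M) :
    ModuleCat.isFG A ((ModuleCat.restrictScalars f.toRingHom).obj M) := by
  have : Module.Finite B M := hM
  let _ : Module R M := Module.compHom M (algebraMap R B)
  let _ : Module A M := Module.compHom M f.toRingHom
  have : IsScalarTower R B M := IsScalarTower.of_algebraMap_smul fun _ _ => rfl
  have : IsScalarTower R A M := IsScalarTower.of_algebraMap_smul fun r x => by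
    change f (algebraMap R A r) • x = algebraMap R B r • x
    rw [f.commutes]
  have : Module.Finite R M := Module.Finite.trans B M
  exact Module.Finite.of_restrictScalars_finite R A M

variable [IsNoetherianRing R]

/-- Restriction of scalars `End(T|F)-Mod ⥤ End(T|G)-Mod` along the projection, for `F ⊆ G`, between
the categories of finitely generated left modules. -/
noncomputable def restrict {F G : Finset D} (h : F ≤ G) :
    FGModuleCat.{u} (EndAlg T F) ⥤ FGModuleCat.{u} (EndAlg T G) :=
  ObjectProperty.lift _
    ((ModuleCat.isFG (EndAlg T F)).ι ⋙ ModuleCat.restrictScalars (proj T h).toRingHom)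
    (fun M => finite_restrict (proj T h) M.obj M.property)

/-- The directed system of the categories `End(T|F)-Mod`, for the finite full subdiagrams `F`. -/
noncomputable def system : Finset D ⥤ Cat where
  obj F := Cat.of (FGModuleCat.{u} (EndAlg T F))
  map h := (restrict T (leOfHom h)).toCatHom
  map_id _ := rfl
  map_comp _ _ := rfl

/-- The diagram category `C(T)`: the direct limit of the categories `End(T|F)-Mod` of finitely
generated left modules over the finite full subdiagrams `F` of `D`. -/
abbrev DiagramCategory := Colim (system T)

/-- `Tp` as a left `End(T|F)`-module, for `p ∈ F`. -/
noncomputable def stalk {F : Finset D} {p : D} (hp : p ∈ F) : FGModuleCat.{u} (EndAlg T F) :=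
  ⟨(ModuleCat.restrictScalars (actionHom T hp).toRingHom).obj
    (ModuleCat.of (Module.End R (T.obj p)) (T.obj p)),
    finite_restrict (actionHom T hp) _ (Module.Finite.of_restrictScalars_finite R _ _)⟩

theorem restrict_stalk {F G : Finset D} (h : F ≤ G) {p : D} (hp : p ∈ F) :
    (restrict T h).obj (stalk T hp) = stalk T (h hp) := rfl

/-- `Tm : Tp → Tq` as a homomorphism of left `End(T|F)`-modules, for `m : p ⟶ q` in `F`. -/
noncomputable def stalkMap {F : Finset D} {p q : D} (hp : p ∈ F) (hq : q ∈ F) (m : p ⟶ q) :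
    stalk T hp ⟶ stalk T hq :=
  ObjectProperty.homMk (ModuleCat.ofHom (X := (stalk T hp).obj) (Y := (stalk T hq).obj)
    { toFun := (T.map m).hom.hom
      map_add' := (T.map m).hom.hom.map_add
      map_smul' := fun e x => LinearMap.congr_fun (e.2 ⟨p, hp⟩ ⟨q, hq⟩ m) x })

theorem cls_stalk {F G : Finset D} {p : D} (hF : p ∈ F) (hG : p ∈ G) :
    cls (C := system T) (i := F) (stalk T hF) = cls (C := system T) (i := G) (stalk T hG) := by
  obtain ⟨H, h, h'⟩ := exists_ge_ge F G
  exact cls_eq_iff.2 ⟨H, h, h', rfl⟩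

open Classical in
/-- The representation `T̃ : D → C(T)`, `p ↦ Tp`, `m ↦ Tm`. -/
noncomputable def tilde : D ⥤q DiagramCategory T where
  obj p := cls (C := system T) (i := {p}) (stalk T (Finset.mem_singleton_self p))
  map {p q} m := homMk (C := system T) (i := {p, q})
    (stalkMap T (Finset.mem_insert_self p {q})
      (Finset.mem_insert_of_mem (Finset.mem_singleton_self q)) m)
    (cls_stalk T _ _) (cls_stalk T _ _)

/-- `T̃ m` is represented by `Tm` over any finite full subdiagram that contains `p` and `q`. -/
theorem tilde_map {F : Finset D} {p q : D} (hp : p ∈ F) (hq : q ∈ F) (m : p ⟶ q) :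
    (tilde T).map m = homMk (C := system T) (i := F) (stalkMap T hp hq m)
      (cls_stalk T _ _) (cls_stalk T _ _) := by
  classical
  obtain ⟨H, h, h'⟩ := exists_ge_ge ({p, q} : Finset D) F
  exact homMk_eq_iff.2 ⟨H, h, h', rfl⟩

/-- For a functor `T` on a category `A`, viewed as a representation of the underlying diagram of
`A`, the representation `T̃` is a functor. -/
noncomputable def tildeFunctor {A : Type t} [Category.{s} A] (T : A ⥤ FGModuleCat.{u} R) :
    A ⥤ DiagramCategory T.toPrefunctor where
  __ := tilde T.toPrefunctor
  map_id p := by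
    refine (tilde_map T.toPrefunctor (Finset.mem_singleton_self p)
      (Finset.mem_singleton_self p) (𝟙 p)).trans (Eq.trans ?_ (id_eq_homMk rfl).symm)
    congr 1
    ext x
    change (T.map (𝟙 p)).hom.hom x = x
    rw [T.map_id]
    rfl
  map_comp {p q r} f g := by
    classical
    have hp : p ∈ ({p, q, r} : Finset A) := by simp
    have hq : q ∈ ({p, q, r} : Finset A) := by simp
    have hr : r ∈ ({p, q, r} : Finset A) := by simp
    change (tilde T.toPrefunctor).map (f ≫ g) =
      (tilde T.toPrefunctor).map f ≫ (tilde T.toPrefunctor).map g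
    rw [tilde_map T.toPrefunctor hp hr (f ≫ g), tilde_map T.toPrefunctor hp hq f,
      tilde_map T.toPrefunctor hq hr g]
    refine Eq.trans ?_ (homMk_comp _ _ _ _ _).symm
    congr 1
    ext x
    change (T.map (f ≫ g)).hom.hom x = (T.map g).hom.hom ((T.map f).hom.hom x)
    rw [T.map_comp]
    rfl

/-- The forgetful functor `ff_T : C(T) ⥤ R-Mod`, which takes the underlying `R`-modules. -/
noncomputable def forgetFunctor : DiagramCategory T ⥤ FGModuleCat.{u} R :=
  desc (C := system T)
    (fun F => ObjectProperty.lift _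
      ((ModuleCat.isFG (EndAlg T F)).ι ⋙ ModuleCat.restrictScalars (algebraMap R (EndAlg T F)))
      (fun M => finite_restrict (Algebra.ofId R (EndAlg T F)) M.obj M.property))
    (fun _ _ _ => rfl)

/-- The factorization `T = ff_T ∘ T̃`. -/
theorem tilde_forget {A : Type t} [Category.{s} A] (T : A ⥤ FGModuleCat.{u} R) :
    tildeFunctor T ⋙ forgetFunctor T.toPrefunctor = T := by
  refine CategoryTheory.Functor.ext (fun _ => rfl) (fun p q f => ?_)
  have key : (show T.obj p ⟶ T.obj q from
      (tildeFunctor T ⋙ forgetFunctor T.toPrefunctor).map f) = T.map f := by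
    ext x
    rfl
  exact key.trans ((Category.id_comp _).trans (Category.comp_id _)).symm

end Nori

/-!
The argument avoids constructing the module objects `Hom_R(Tp, p)` inside `A`. It rests on *generic
elements* (`GenericElement`). For a finite set `F` of objects, there is an object `X` of `A`, an
element `t` of `TX`, and for each `q ∈ F` and `z ∈ Tq` a morphism `σ_q(z) : X ⟶ q`, linear and
natural in `z`, with `T(σ_q(z))(t) = z`. To find it (`nonempty_genericElement`), take a sum `Y` of
copies of the objects of `F` and the element `t` of `TY` made of generators of the modules `Tq`:
every `z` is some `T(α)(t)` with `α : Y ⟶ q`, and `α` becomes unique on the common kernel `X` of all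
`α` with `T(α)(t) = 0`. As `R` is noetherian and `T` is faithful, finitely many `α` suffice, so `X`
exists, and by exactness `t` lies in `TX`.

Each `x ∈ TX` then defines an element `e_x` of `End(T|F)`, with `e_x(z) = T(σ_q(z))(x)`
(`GenericElement.toEnd`). Moreover `e_t = 1`, and `e_{gx} = g e_x` for endomorphisms `g` over a
finite set containing `F` and `X`. Consequences:

* For `y ∈ F` and `z ∈ Ty`, the image of `T(σ_y(z))` consists of the `e_x(z)` and contains `z`. Hence
  every `End(T|F)`-submodule of `Ty` is the image of `Tf` for a morphism `f` (`exists_range_lin_eq`).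
* Applied to the graph of an `End(T|F)`-linear map `Tp → Tq`, this yields a morphism `p ⟶ q`
  inducing it, so the functor is full (`exists_lin_eq`).
* For a finitely generated `End(T|F)`-module `M` and `m ∈ M`, the map `x ↦ e_x m` is linear over the
  endomorphisms of a larger diagram and hits `m`. Sums of such maps cover `M` by some `TV`; the kernel
  is the image of some `Tf`, so `M` is `T` of the cokernel of `f` (`exists_linearEquiv`), and the
  functor is essentially surjective.
-/

namespace Nori

open DirectedColimit Limits ZeroObject

/-! ### Exact functors to modules, elementwise -/

section Exactness

variable {R : Type u} [CommRing R] {A : Type t} [Category.{s} A] (T : A ⥤ FGModuleCat.{u} R)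

/-- The underlying `R`-linear map of `T f`. -/
abbrev lin {X Y : A} (f : X ⟶ Y) : T.obj X →ₗ[R] T.obj Y := (T.map f).hom.hom

theorem lin_comp {X Y Z : A} (f : X ⟶ Y) (g : Y ⟶ Z) (x : T.obj X) :
    lin T (f ≫ g) x = lin T g (lin T f x) := by
  simp only [lin, T.map_comp]
  rfl

theorem lin_id {X : A} (x : T.obj X) : lin T (𝟙 X) x = x := by
  simp only [lin, T.map_id]
  rfl

theorem hom_ext_of_lin [T.Faithful] {X Y : A} {f g : X ⟶ Y}
    (h : ∀ x, lin T f x = lin T g x) : f = g :=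
  T.map_injective (FGModuleCat.hom_ext (LinearMap.ext h))

theorem epi_of_surjective [T.Faithful] {X Y : A} (f : X ⟶ Y)
    (hf : Function.Surjective (lin T f)) : Epi f := by
  refine ⟨fun g h e => hom_ext_of_lin T fun y => ?_⟩
  obtain ⟨x, rfl⟩ := hf y
  rw [← lin_comp, e, lin_comp]

variable [Abelian A]

theorem additive_of_exact [IsNoetherianRing R] [PreservesFiniteLimits T] : T.Additive := by
  have : T.PreservesZeroMorphisms :=
    Functor.preservesZeroMorphisms_of_preserves_terminal_object
  exact Functor.additive_of_preserves_binary_products T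

theorem lin_smul [Linear R A] [T.Linear R] {X Y : A} (r : R) (f : X ⟶ Y) (x : T.obj X) :
    lin T (r • f) x = r • lin T f x := by
  simp only [lin, T.map_smul]
  rfl

section

variable [T.Additive]

theorem lin_add {X Y : A} (f g : X ⟶ Y) (x : T.obj X) :
    lin T (f + g) x = lin T f x + lin T g x := by
  simp only [lin, T.map_add]
  rfl

theorem lin_sub {X Y : A} (f g : X ⟶ Y) (x : T.obj X) :
    lin T (f - g) x = lin T f x - lin T g x := by
  simp only [lin, T.map_sub]
  rfl

theorem lin_zero {X Y : A} (x : T.obj X) : lin T (0 : X ⟶ Y) x = 0 := by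
  simp only [lin, T.map_zero]
  rfl

/-- Evaluation at an element `x` of `TX`, as a linear map on `Hom(X, Y)`. -/
def evalAt [Linear R A] [T.Linear R] {X : A} (x : T.obj X) (Y : A) : (X ⟶ Y) →ₗ[R] T.obj Y where
  toFun f := lin T f x
  map_add' f g := lin_add T f g x
  map_smul' r f := lin_smul T r f x

theorem isNoetherian_hom [IsNoetherianRing R] [Linear R A] [T.Linear R] [T.Faithful] (X Y : A) :
    IsNoetherian R (X ⟶ Y) := by
  let L : (X ⟶ Y) →ₗ[R] (T.obj X →ₗ[R] T.obj Y) :=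
    { toFun := fun f => lin T f
      map_add' := fun f g => LinearMap.ext (lin_add T f g)
      map_smul' := fun r f => LinearMap.ext (lin_smul T r f) }
  exact isNoetherian_of_injective L
    fun f g h => hom_ext_of_lin T fun x => LinearMap.congr_fun h x

end

variable [IsNoetherianRing R] [PreservesFiniteLimits T] [PreservesFiniteColimits T]

theorem exists_lin_eq_of_exact (S : ShortComplex A) (h : S.Exact) (x : T.obj S.X₂)
    (hx : lin T S.g x = 0) : ∃ y, lin T S.f y = x := by
  have := additive_of_exact T
  let U := T ⋙ forget₂ (FGModuleCat.{u} R) (ModuleCat.{u} R)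
  have : U.Additive := inferInstance
  have : PreservesFiniteLimits U := inferInstance
  have : PreservesFiniteColimits U := inferInstance
  exact (ShortComplex.moduleCat_exact_iff _).1 (h.map U) x hx

theorem exists_lin_kernel_ι_eq {X Y : A} (f : X ⟶ Y) (x : T.obj X) (hx : lin T f x = 0) :
    ∃ y, lin T (kernel.ι f) y = x :=
  exists_lin_eq_of_exact T _ (ShortComplex.exact_kernel f) x hx

theorem exists_lin_eq_of_cokernel {X Y : A} (f : X ⟶ Y) (y : T.obj Y)
    (hy : lin T (cokernel.π f) y = 0) : ∃ x, lin T f x = y :=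
  exists_lin_eq_of_exact T _ (ShortComplex.exact_cokernel f) y hy

theorem surjective_of_epi {X Y : A} (f : X ⟶ Y) [Epi f] : Function.Surjective (lin T f) := by
  have := additive_of_exact T
  intro y
  exact exists_lin_eq_of_exact T ⟨f, (0 : Y ⟶ Y), comp_zero⟩
    ((ShortComplex.exact_iff_epi _ rfl).2 ‹_›) y (lin_zero T y)

end Exactness

/-! ### Generic elements of a finite subdiagram -/

section Generic

variable {R : Type u} [CommRing R] {A : Type t} [Category.{s} A] [Abelian A] [Linear R A]
  (T : A ⥤ FGModuleCat.{u} R)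

/-- A generic element over `F`: an element `elt` of `T` of some object, together with a choice,
natural and linear in `z`, of a morphism that sends `elt` to a prescribed element `z` of `Tq`,
for `q ∈ F`. -/
structure GenericElement (F : Finset A) where
  obj : A
  elt : T.obj obj
  toHom : ∀ q ∈ F, T.obj q →ₗ[R] (obj ⟶ q)
  lin_toHom : ∀ (q : A) (hq : q ∈ F) (z : T.obj q), lin T (toHom q hq z) elt = z
  toHom_comp : ∀ (p q : A) (hp : p ∈ F) (hq : q ∈ F) (m : p ⟶ q) (z : T.obj p),
    toHom p hp z ≫ m = toHom q hq (lin T m z)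

/-- If the morphisms `α` of a finitely generated submodule of `Hom(Y, q)` annihilate `Ti(x)`, they
can be made zero by passing to iterated kernels, to which `x` lifts since `T` is left exact. -/
theorem exists_kill_submodule [IsNoetherianRing R] [PreservesFiniteLimits T]
    [PreservesFiniteColimits T] {Y q : A} (K : Submodule R (Y ⟶ q)) (hK : K.FG) :
    ∀ {X : A} (i : X ⟶ Y) (x : T.obj X), (∀ α ∈ K, lin T α (lin T i x) = 0) →
      ∃ (X' : A) (j : X' ⟶ X) (x' : T.obj X'), lin T j x' = x ∧ ∀ α ∈ K, j ≫ i ≫ α = 0 := by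
  induction K, hK using Submodule.fg_induction with
  | singleton α =>
    intro X i x hx
    obtain ⟨y, hy⟩ := exists_lin_kernel_ι_eq T (i ≫ α) x
      (by rw [lin_comp]; exact hx α (Submodule.mem_span_singleton_self α))
    refine ⟨kernel (i ≫ α), kernel.ι _, y, hy, fun β hβ => ?_⟩
    obtain ⟨r, rfl⟩ := Submodule.mem_span_singleton.1 hβ
    rw [Linear.comp_smul, Linear.comp_smul, kernel.condition, smul_zero]
  | sup K₁ K₂ _ _ h₁ h₂ =>
    intro X i x hx
    obtain ⟨X₁, j₁, x₁, e₁, h₁⟩ := h₁ i x fun α hα => hx α (Submodule.mem_sup_left hα)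
    obtain ⟨X₂, j₂, x₂, e₂, h₂⟩ := h₂ (j₁ ≫ i) x₁ fun α hα => by
      rw [lin_comp, e₁]
      exact hx α (Submodule.mem_sup_right hα)
    refine ⟨X₂, j₂ ≫ j₁, x₂, by rw [lin_comp, e₂, e₁], fun α hα => ?_⟩
    obtain ⟨α₁, hα₁, α₂, hα₂, rfl⟩ := Submodule.mem_sup.1 hα
    have := h₂ α₂ hα₂
    simp only [Category.assoc] at this
    simp only [Preadditive.comp_add, Category.assoc, h₁ α₁ hα₁, this, comp_zero, add_zero]

variable [T.Linear R]

/-- The elements of a finitely generated submodule are images of a single element. -/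
theorem exists_cyclic_submodule (q : A) (N : Submodule R (T.obj q)) (hN : N.FG) :
    ∃ (Y : A) (t : T.obj Y), ∀ z ∈ N, ∃ α : Y ⟶ q, lin T α t = z := by
  induction N, hN using Submodule.fg_induction with
  | singleton x =>
    refine ⟨q, x, fun z hz => ?_⟩
    obtain ⟨r, rfl⟩ := Submodule.mem_span_singleton.1 hz
    exact ⟨r • 𝟙 q, by rw [lin_smul, lin_id]⟩
  | sup N₁ N₂ _ _ h₁ h₂ =>
    obtain ⟨Y₁, t₁, h₁⟩ := h₁
    obtain ⟨Y₂, t₂, h₂⟩ := h₂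
    refine ⟨Y₁ ⊞ Y₂, lin T biprod.inl t₁ + lin T biprod.inr t₂, fun z hz => ?_⟩
    obtain ⟨z₁, hz₁, z₂, hz₂, rfl⟩ := Submodule.mem_sup.1 hz
    obtain ⟨α₁, rfl⟩ := h₁ z₁ hz₁
    obtain ⟨α₂, rfl⟩ := h₂ z₂ hz₂
    exact ⟨biprod.desc α₁ α₂, by
      rw [map_add, ← lin_comp, ← lin_comp, biprod.inl_desc, biprod.inr_desc]⟩

variable [T.Additive]

/-- One element `t` of `T` of some object has every element of every `Tq`, `q ∈ F`, as an image
`T(α)(t)`. -/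
theorem exists_cyclic (F : Finset A) :
    ∃ (Y : A) (t : T.obj Y), ∀ q ∈ F, ∀ z : T.obj q, ∃ α : Y ⟶ q, lin T α t = z := by
  classical
  induction F using Finset.induction_on with
  | empty => exact ⟨(0 : A), 0, by simp⟩
  | insert p F _ h =>
    obtain ⟨Y₁, t₁, h₁⟩ := exists_cyclic_submodule T p ⊤ Module.Finite.fg_top
    obtain ⟨Y₂, t₂, h₂⟩ := h
    refine ⟨Y₁ ⊞ Y₂, lin T biprod.inl t₁ + lin T biprod.inr t₂, fun q hq z => ?_⟩
    rcases Finset.mem_insert.1 hq with rfl | hq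
    · obtain ⟨α, rfl⟩ := h₁ z trivial
      exact ⟨biprod.desc α 0, by
        rw [map_add, ← lin_comp, ← lin_comp, biprod.inl_desc, biprod.inr_desc, lin_zero, add_zero]⟩
    · obtain ⟨α, rfl⟩ := h₂ q hq z
      exact ⟨biprod.desc 0 α, by
        rw [map_add, ← lin_comp, ← lin_comp, biprod.inl_desc, biprod.inr_desc, lin_zero, zero_add]⟩

variable [IsNoetherianRing R] [PreservesFiniteLimits T] [PreservesFiniteColimits T]

variable [T.Faithful]

/-- All relations `T(α)(t) = 0` with `α : Y ⟶ q` and `q ∈ F` are imposed on some `j : X ⟶ Y` such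
that `t` lifts to `TX`. They are finitely generated: `Hom(Y, q)` embeds into the noetherian module
`Hom(TY, Tq)` by faithfulness. -/
theorem exists_kill {Y : A} (t : T.obj Y) (F : Finset A) :
    ∃ (X : A) (j : X ⟶ Y) (x : T.obj X), lin T j x = t ∧
      ∀ q ∈ F, ∀ α : Y ⟶ q, lin T α t = 0 → j ≫ α = 0 := by
  classical
  induction F using Finset.induction_on with
  | empty => exact ⟨Y, 𝟙 Y, t, lin_id T t, by simp⟩
  | insert p F _ h =>
    obtain ⟨X, j, x, e, h⟩ := h
    have := isNoetherian_hom T Y p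
    obtain ⟨X', j', x', e', h'⟩ := exists_kill_submodule T (LinearMap.ker (evalAt T t p))
      (IsNoetherian.noetherian _) j x fun α hα => by rw [e]; exact hα
    refine ⟨X', j' ≫ j, x', by rw [lin_comp, e', e], fun q hq α hα => ?_⟩
    rcases Finset.mem_insert.1 hq with rfl | hq
    · rw [Category.assoc, h' α hα]
    · rw [Category.assoc, h q hq α hα, comp_zero]

/-- The lift `x` of `t` provided by `exists_kill` is generic: `z = T(α)(t)` determines `j ≫ α`,
which is therefore linear and natural in `z`. -/
theorem nonempty_genericElement (F : Finset A) : Nonempty (GenericElement T F) := by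
  obtain ⟨Y, t, hY⟩ := exists_cyclic T F
  obtain ⟨X, j, x, e, hX⟩ := exists_kill T t F
  choose σ hσ using hY
  -- morphisms out of `Y` that agree on `t` become equal on `X`
  have key : ∀ q ∈ F, ∀ α β : Y ⟶ q, lin T α t = lin T β t → j ≫ α = j ≫ β := by
    intro q hq α β h
    rw [← sub_eq_zero, ← Preadditive.comp_sub]
    exact hX q hq _ (by rw [lin_sub, h, sub_self])
  exact ⟨{
    obj := X
    elt := x
    toHom := fun q hq =>
      { toFun := fun z => j ≫ σ q hq z
        map_add' := fun z z' => by
          rw [← Preadditive.comp_add]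
          exact key q hq _ _ (by simp only [lin_add, hσ])
        map_smul' := fun r z => by
          rw [RingHom.id_apply, ← Linear.comp_smul]
          exact key q hq _ _ (by simp only [lin_smul, hσ]) }
    lin_toHom := fun q hq z => (lin_comp T _ _ _).trans (by rw [e, hσ])
    toHom_comp := fun p q hp hq m z => by
      change (j ≫ σ p hp z) ≫ m = j ≫ σ q hq (lin T m z)
      rw [Category.assoc]
      exact key q hq _ _ (by simp only [lin_comp, hσ]) }⟩

end Generic

/-! ### The action of the endomorphism algebras -/

section Action

variable {R : Type u} [CommRing R] {A : Type t} [Category.{s} A] (T : A ⥤ FGModuleCat.{u} R)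

/-- The action of `e ∈ End(T|F)` on `Tp`, for `p ∈ F`. -/
abbrev act {F : Finset A} {p : A} (hp : p ∈ F) (e : EndAlg T.toPrefunctor F) :
    T.obj p →ₗ[R] T.obj p :=
  e.1 ⟨p, hp⟩

theorem lin_act {F : Finset A} {p q : A} (hp : p ∈ F) (hq : q ∈ F) (m : p ⟶ q)
    (e : EndAlg T.toPrefunctor F) (x : T.obj p) :
    lin T m (act T hp e x) = act T hq e (lin T m x) :=
  LinearMap.congr_fun (e.2 ⟨p, hp⟩ ⟨q, hq⟩ m) x

variable [Abelian A] [Linear R A] [T.Linear R] [T.Additive]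

variable {T} in
/-- An element `x` of `T` of the object that carries a generic element `elt` over `F` defines an
endomorphism of `T|F`, the one with `T(α)(elt) ↦ T(α)(x)` for the chosen morphisms `α`. -/
def GenericElement.toEnd {F : Finset A} (G : GenericElement T F) :
    T.obj G.obj →ₗ[R] EndAlg T.toPrefunctor F where
  toFun x :=
    ⟨fun q => (evalAt T x q.1) ∘ₗ G.toHom q.1 q.2, fun p q m => LinearMap.ext fun z => by
      change lin T m (lin T (G.toHom p.1 p.2 z) x) = lin T (G.toHom q.1 q.2 (lin T m z)) x
      exact (lin_comp T _ _ _).symm.trans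
        (congrArg (fun k => lin T k x) (G.toHom_comp p.1 q.1 p.2 q.2 m z))⟩
  map_add' x y := Subtype.ext <| funext fun q => LinearMap.ext fun z =>
    map_add (lin T (G.toHom q.1 q.2 z)) x y
  map_smul' r x := Subtype.ext <| funext fun q => LinearMap.ext fun z =>
    map_smul (lin T (G.toHom q.1 q.2 z)) r x

variable {F : Finset A} (G : GenericElement T F)

theorem act_toEnd {q : A} (hq : q ∈ F) (x : T.obj G.obj) (z : T.obj q) :
    act T hq (G.toEnd x) z = lin T (G.toHom q hq z) x := rfl

theorem toEnd_elt : G.toEnd G.elt = 1 :=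
  Subtype.ext <| funext fun q => LinearMap.ext fun z => G.lin_toHom q.1 q.2 z

theorem toEnd_act {H : Finset A} (h : F ≤ H) (hG : G.obj ∈ H) (g : EndAlg T.toPrefunctor H)
    (x : T.obj G.obj) :
    G.toEnd (act T hG g x) = proj T.toPrefunctor h g * G.toEnd x :=
  Subtype.ext <| funext fun q => LinearMap.ext fun z =>
    lin_act T hG (h q.2) (G.toHom q.1 q.2 z) g x

variable [IsNoetherianRing R] [PreservesFiniteLimits T] [PreservesFiniteColimits T] [T.Faithful]

/-- An `End(T|F)`-submodule of `Ty`, for `y ∈ F`, is the image of `Tf` for a morphism `f` of `A`. -/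
theorem exists_range_lin_eq {F : Finset A} {y : A} (hy : y ∈ F) (N : Submodule R (T.obj y))
    (hN : ∀ (e : EndAlg T.toPrefunctor F), ∀ z ∈ N, act T hy e z ∈ N) :
    ∃ (Z : A) (f : Z ⟶ y), LinearMap.range (lin T f) = N := by
  obtain ⟨G⟩ := nonempty_genericElement T F
  have key : ∀ S : Submodule R (T.obj y), S.FG → S ≤ N →
      ∃ (Z : A) (f : Z ⟶ y), S ≤ LinearMap.range (lin T f) ∧ LinearMap.range (lin T f) ≤ N := by
    intro S hS
    induction S, hS using Submodule.fg_induction with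
    | singleton z =>
      intro hz
      refine ⟨G.obj, G.toHom y hy z, ?_, ?_⟩
      · rw [Submodule.span_singleton_le_iff_mem]
        exact ⟨G.elt, G.lin_toHom y hy z⟩
      · rintro _ ⟨x, rfl⟩
        exact hN (G.toEnd x) z (hz (Submodule.mem_span_singleton_self z))
    | sup S₁ S₂ _ _ h₁ h₂ =>
      intro hS
      obtain ⟨Z₁, f₁, h₁, h₁'⟩ := h₁ (le_sup_left.trans hS)
      obtain ⟨Z₂, f₂, h₂, h₂'⟩ := h₂ (le_sup_right.trans hS)
      refine ⟨Z₁ ⊞ Z₂, biprod.desc f₁ f₂, sup_le (fun z hz => ?_) (fun z hz => ?_), ?_⟩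
      · obtain ⟨x, rfl⟩ := h₁ hz
        exact ⟨lin T biprod.inl x, by rw [← lin_comp, biprod.inl_desc]⟩
      · obtain ⟨x, rfl⟩ := h₂ hz
        exact ⟨lin T biprod.inr x, by rw [← lin_comp, biprod.inr_desc]⟩
      · rintro _ ⟨x, rfl⟩
        rw [biprod.desc_eq, lin_add, lin_comp, lin_comp]
        exact N.add_mem (h₁' ⟨_, rfl⟩) (h₂' ⟨_, rfl⟩)
  obtain ⟨Z, f, h, h'⟩ := key N (IsNoetherian.noetherian N) le_rfl
  exact ⟨Z, f, le_antisymm h' h⟩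

/-- An `End(T|F)`-linear map `Tp → Tq` comes from a morphism of `A`: its graph is the image of
some `Tf`, and the first component of `f` is an epimorphism over which the second one descends. -/
theorem exists_lin_eq {F : Finset A} {p q : A} (hp : p ∈ F) (hq : q ∈ F)
    (φ : T.obj p →ₗ[R] T.obj q)
    (hφ : ∀ (e : EndAlg T.toPrefunctor F) (x : T.obj p), φ (act T hp e x) = act T hq e (φ x)) :
    ∃ f : p ⟶ q, lin T f = φ := by
  classical
  obtain ⟨Z, f, hf⟩ := exists_range_lin_eq T (Finset.mem_insert_self (p ⊞ q) F)
    (LinearMap.ker (φ ∘ₗ lin T (biprod.fst : p ⊞ q ⟶ p) - lin T (biprod.snd : p ⊞ q ⟶ q)))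
    (fun e w hw => by
      rw [LinearMap.mem_ker, LinearMap.sub_apply, sub_eq_zero, LinearMap.comp_apply] at hw ⊢
      rw [lin_act T _ (Finset.mem_insert_of_mem hp), lin_act T _ (Finset.mem_insert_of_mem hq),
        ← hw]
      exact hφ (proj T.toPrefunctor (Finset.subset_insert _ F) e) _)
  have graph : ∀ z, φ (lin T (f ≫ biprod.fst) z) = lin T (f ≫ biprod.snd) z := fun z => by
    have : lin T f z ∈ LinearMap.range (lin T f) := ⟨z, rfl⟩
    rw [hf, LinearMap.mem_ker, LinearMap.sub_apply, sub_eq_zero] at this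
    rw [lin_comp, lin_comp]
    exact this
  have surj : Function.Surjective (lin T (f ≫ biprod.fst)) := fun x => by
    have : lin T (biprod.inl : p ⟶ p ⊞ q) x + lin T biprod.inr (φ x) ∈
        LinearMap.range (lin T f) := by
      rw [hf, LinearMap.mem_ker]
      simp only [LinearMap.sub_apply, LinearMap.comp_apply, map_add, ← lin_comp, biprod.inl_fst,
        biprod.inr_fst, biprod.inl_snd, biprod.inr_snd, lin_id, lin_zero, map_zero, sub_zero,
        zero_sub, add_neg_cancel]
    obtain ⟨z, hz⟩ := this
    refine ⟨z, ?_⟩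
    rw [lin_comp, hz]
    simp only [map_add, ← lin_comp, biprod.inl_fst, biprod.inr_fst, lin_id, lin_zero, add_zero]
  have := epi_of_surjective T _ surj
  refine ⟨Abelian.epiDesc (f ≫ biprod.fst) (f ≫ biprod.snd) (hom_ext_of_lin T fun k => ?_),
    LinearMap.ext fun x => ?_⟩
  · rw [lin_comp, ← graph, ← lin_comp, kernel.condition, lin_zero, lin_zero, map_zero]
  · obtain ⟨z, rfl⟩ := surj x
    rw [← lin_comp, Abelian.comp_epiDesc, graph]

section Module

variable {F : Finset A} (M : Type u) [AddCommGroup M] [Module R M]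
  [Module (EndAlg T.toPrefunctor F) M] [IsScalarTower R (EndAlg T.toPrefunctor F) M]

/-- A finitely generated submodule of an `End(T|F)`-module is covered by some `TV`, compatibly with
the actions: a generic element over `F`, carried by `V`, gives the map `x ↦ e_x • m`. -/
theorem exists_cover_submodule (S : Submodule R M) (hS : S.FG) :
    ∃ (H : Finset A) (h : F ≤ H) (V : A) (hV : V ∈ H) (ψ : T.obj V →ₗ[R] M),
      S ≤ LinearMap.range ψ ∧
        ∀ (g : EndAlg T.toPrefunctor H) x, ψ (act T hV g x) = proj T.toPrefunctor h g • ψ x := by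
  classical
  induction S, hS using Submodule.fg_induction with
  | singleton m =>
    obtain ⟨G⟩ := nonempty_genericElement T F
    refine ⟨insert G.obj F, Finset.subset_insert _ _, G.obj, Finset.mem_insert_self _ _,
      (LinearMap.toSpanSingleton (EndAlg T.toPrefunctor F) M m).restrictScalars R ∘ₗ G.toEnd,
      ?_, fun g x => ?_⟩
    · rw [Submodule.span_singleton_le_iff_mem]
      refine ⟨G.elt, ?_⟩
      change G.toEnd G.elt • m = m
      rw [toEnd_elt, one_smul]
    · change G.toEnd _ • m = _ • G.toEnd x • m
      rw [toEnd_act T G (Finset.subset_insert _ _), mul_smul]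
  | sup S₁ S₂ _ _ h₁ h₂ =>
    obtain ⟨H₁, i₁, V₁, hV₁, ψ₁, r₁, h₁⟩ := h₁
    obtain ⟨H₂, i₂, V₂, hV₂, ψ₂, r₂, h₂⟩ := h₂
    have le₁ : H₁ ≤ insert (V₁ ⊞ V₂) (H₁ ∪ H₂) :=
      Finset.subset_union_left.trans (Finset.subset_insert _ _)
    have le₂ : H₂ ≤ insert (V₁ ⊞ V₂) (H₁ ∪ H₂) :=
      Finset.subset_union_right.trans (Finset.subset_insert _ _)
    refine ⟨insert (V₁ ⊞ V₂) (H₁ ∪ H₂), i₁.trans le₁, V₁ ⊞ V₂, Finset.mem_insert_self _ _,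
      ψ₁ ∘ₗ lin T biprod.fst + ψ₂ ∘ₗ lin T biprod.snd,
      sup_le (fun z hz => ?_) (fun z hz => ?_), fun g x => ?_⟩
    · obtain ⟨x, rfl⟩ := r₁ hz
      refine ⟨lin T biprod.inl x, ?_⟩
      simp only [LinearMap.add_apply, LinearMap.comp_apply, ← lin_comp, biprod.inl_fst,
        biprod.inl_snd, lin_id, lin_zero, map_zero, add_zero]
    · obtain ⟨x, rfl⟩ := r₂ hz
      refine ⟨lin T biprod.inr x, ?_⟩
      simp only [LinearMap.add_apply, LinearMap.comp_apply, ← lin_comp, biprod.inr_fst,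
        biprod.inr_snd, lin_id, lin_zero, map_zero, zero_add]
    · simp only [LinearMap.add_apply, LinearMap.comp_apply, smul_add]
      rw [lin_act T _ (le₁ hV₁), lin_act T _ (le₂ hV₂)]
      exact congrArg₂ (· + ·) (h₁ (proj T.toPrefunctor le₁ g) _)
        (h₂ (proj T.toPrefunctor le₂ g) _)

/-- Every finitely generated `End(T|F)`-module is isomorphic to some `TQ`, as a module over
`End(T|H)` for a larger finite subdiagram `H`. -/
theorem exists_linearEquiv [Module.Finite R M] :
    ∃ (H : Finset A) (h : F ≤ H) (Q : A) (hQ : Q ∈ H) (ψ : T.obj Q ≃ₗ[R] M),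
      ∀ (g : EndAlg T.toPrefunctor H) x, ψ (act T hQ g x) = proj T.toPrefunctor h g • ψ x := by
  classical
  obtain ⟨H, h, V, hV, ψ, hr, hψ⟩ :=
    exists_cover_submodule T (F := F) M ⊤ Module.Finite.fg_top
  obtain ⟨Z, f, hf⟩ := exists_range_lin_eq T hV (LinearMap.ker ψ) fun e z hz => by
    rw [LinearMap.mem_ker] at hz ⊢
    rw [hψ, hz, smul_zero]
  have surj := surjective_of_epi T (cokernel.π f)
  have hker : LinearMap.ker (lin T (cokernel.π f)) = LinearMap.ker ψ := by
    rw [← hf]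
    refine le_antisymm (fun y hy => exists_lin_eq_of_cokernel T f y hy) ?_
    rintro _ ⟨x, rfl⟩
    rw [LinearMap.mem_ker, ← lin_comp, cokernel.condition, lin_zero]
  let Ψ : T.obj (cokernel f) ≃ₗ[R] M :=
    (LinearMap.quotKerEquivOfSurjective _ surj).symm ≪≫ₗ Submodule.quotEquivOfEq _ _ hker ≪≫ₗ
      LinearMap.quotKerEquivOfSurjective ψ (LinearMap.range_eq_top.1 (top_le_iff.1 hr))
  have hΨ : ∀ y, Ψ (lin T (cokernel.π f) y) = ψ y := fun y => by
    have : (LinearMap.quotKerEquivOfSurjective _ surj).symm (lin T (cokernel.π f) y) =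
        Submodule.Quotient.mk y := by
      rw [LinearEquiv.symm_apply_eq]
      rfl
    simp only [Ψ, LinearEquiv.trans_apply, this]
    rfl
  refine ⟨insert (cokernel f) H, h.trans (Finset.subset_insert _ _), cokernel f,
    Finset.mem_insert_self _ _, Ψ, fun g x => ?_⟩
  obtain ⟨y, rfl⟩ := surj x
  rw [← lin_act T (Finset.mem_insert_of_mem hV), hΨ, hΨ]
  exact hψ (proj T.toPrefunctor (Finset.subset_insert _ _) g) y

end Module

end Action

/-! ### The functor to the diagram category -/

section Equivalence

variable {R : Type u} [CommRing R] [IsNoetherianRing R] {A : Type t} [Category.{s} A]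
  (T : A ⥤ FGModuleCat.{u} R)

theorem faithful_tildeFunctor [T.Faithful] : (tildeFunctor T).Faithful := by
  have : (tildeFunctor T ⋙ forgetFunctor T.toPrefunctor).Faithful := by
    rw [tilde_forget]
    infer_instance
  exact Functor.Faithful.of_comp (tildeFunctor T) (forgetFunctor T.toPrefunctor)

theorem exists_arrow_eq {B : Type*} [Category B] {a b a' b' : B} (f : a ⟶ b) (ha : a = a')
    (hb : b = b') : ∃ g : a' ⟶ b', Arrow.mk f = Arrow.mk g := by
  subst ha hb
  exact ⟨f, rfl⟩

/-- A morphism `T̃p → T̃q` is represented by a linear map `Tp → Tq` over a finite subdiagram. -/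
theorem exists_stalk_hom {p q : A} (φ : (tildeFunctor T).obj p ⟶ (tildeFunctor T).obj q) :
    ∃ (F : Finset A) (hp : p ∈ F) (hq : q ∈ F)
      (g : stalk T.toPrefunctor hp ⟶ stalk T.toPrefunctor hq),
      φ = homMk (C := system T.toPrefunctor) (i := F) g (cls_stalk _ _ _) (cls_stalk _ _ _) := by
  induction φ using Quotient.ind with | _ φ => ?_
  obtain ⟨i, a, b, f, ha, hb⟩ := φ
  obtain ⟨F₁, i₁, j₁, e₁⟩ := cls_eq_iff.1 ha
  obtain ⟨F₂, i₂, j₂, e₂⟩ := cls_eq_iff.1 hb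
  obtain ⟨F, h₁, h₂⟩ := exists_ge_ge F₁ F₂
  have hp : p ∈ F := h₁ (j₁ (Finset.mem_singleton_self p))
  have hq : q ∈ F := h₂ (j₂ (Finset.mem_singleton_self q))
  have E₁ : (tr (system T.toPrefunctor) (i₁.trans h₁)).obj a = stalk T.toPrefunctor hp := by
    rw [← tr_obj _ i₁ h₁, e₁]
    rfl
  have E₂ : (tr (system T.toPrefunctor) (i₁.trans h₁)).obj b = stalk T.toPrefunctor hq := by
    change (tr (system T.toPrefunctor) (i₂.trans h₂)).obj b = _
    rw [← tr_obj _ i₂ h₂, e₂]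
    rfl
  obtain ⟨g, hg⟩ := exists_arrow_eq
    ((tr (system T.toPrefunctor) (i₁.trans h₁)).map f) E₁ E₂
  refine ⟨F, hp, hq, g, homMk_eq_iff.2 ?_⟩
  have := agree_push (C := system T.toPrefunctor) (i₁.trans h₁) (Arrow.mk f)
  rw [push] at this
  exact (hg ▸ this).symm

variable [Abelian A] [Linear R A] [T.Linear R] [T.Faithful]
  [PreservesFiniteLimits T] [PreservesFiniteColimits T]

theorem full_tildeFunctor : (tildeFunctor T).Full where
  map_surjective {p q} φ := by
    have := additive_of_exact T
    obtain ⟨F, hp, hq, g, rfl⟩ := exists_stalk_hom T φ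
    obtain ⟨f, hf⟩ := exists_lin_eq T hp hq
      { toFun := g.hom.hom
        map_add' := g.hom.hom.map_add
        map_smul' := fun r x => g.hom.hom.map_smul (algebraMap R _ r) x }
      (fun e x => g.hom.hom.map_smul e x)
    refine ⟨f, (tilde_map T.toPrefunctor hp hq f).trans ?_⟩
    congr 1
    ext x
    exact LinearMap.congr_fun hf x

theorem essSurj_tildeFunctor : (tildeFunctor T).EssSurj where
  mem_essImage x := by
    have := additive_of_exact T
    obtain ⟨⟨F, M⟩, rfl⟩ := Quotient.exists_rep x
    let M' : FGModuleCat.{u} (EndAlg T.toPrefunctor F) := M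
    let _ : Module R M' := Module.compHom M' (algebraMap R (EndAlg T.toPrefunctor F))
    have : IsScalarTower R (EndAlg T.toPrefunctor F) M' :=
      IsScalarTower.of_algebraMap_smul fun _ _ => rfl
    have : Module.Finite R M' := Module.Finite.trans (EndAlg T.toPrefunctor F) M'
    obtain ⟨H, h, Q, hQ, ψ, hψ⟩ := exists_linearEquiv T (F := F) M'
    let e : stalk T.toPrefunctor hQ ≅ (restrict T.toPrefunctor h).obj M' :=
      { hom := ObjectProperty.homMk (ModuleCat.ofHom (X := (stalk T.toPrefunctor hQ).obj)
          (Y := ((restrict T.toPrefunctor h).obj M').obj)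
          { toFun := ψ
            map_add' := ψ.map_add
            map_smul' := hψ })
        inv := ObjectProperty.homMk (ModuleCat.ofHom
          (X := ((restrict T.toPrefunctor h).obj M').obj) (Y := (stalk T.toPrefunctor hQ).obj)
          { toFun := ψ.symm
            map_add' := ψ.symm.map_add
            map_smul' := fun g m => ψ.symm_apply_eq.2 ((hψ g (ψ.symm m)).trans
              (congrArg (fun y : M' => proj T.toPrefunctor h g • y)
                (ψ.apply_symm_apply m))).symm })
        hom_inv_id := FGModuleCat.hom_ext (LinearMap.ext ψ.symm_apply_apply)
        inv_hom_id := FGModuleCat.hom_ext (LinearMap.ext ψ.apply_symm_apply) }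
    exact ⟨Q, ⟨eqToIso (cls_stalk _ _ hQ) ≪≫ (ι (C := system T.toPrefunctor) H).mapIso e ≪≫
      eqToIso (cls_tr (C := system T.toPrefunctor) h M')⟩⟩

end Equivalence

end Nori

theorem mainTheorem2 {R : Type u} [CommRing R] [IsNoetherianRing R]
    {A : Type t} [Category.{s} A] [Abelian A] [Linear R A]
    (T : A ⥤ FGModuleCat.{u} R) [T.Faithful] [T.Linear R]
    [Limits.PreservesFiniteLimits T] [Limits.PreservesFiniteColimits T] :
    Nori.tildeFunctor T ⋙ Nori.forgetFunctor T.toPrefunctor = T ∧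
      (Nori.tildeFunctor T).IsEquivalence :=
  ⟨Nori.tilde_forget T,
    { faithful := Nori.faithful_tildeFunctor T
      full := Nori.full_tildeFunctor T
      essSurj := Nori.essSurj_tildeFunctor T }⟩
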